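/- \textbf{Setting.} Formulas are built from a denumerable set of variables with the binary connectives $\&,\wedge,\to$ and the constant $\bot$; put $\varphi\vee\psi:=((\varphi\to\psi)\to\psi)\wedge((\psi\to\varphi)\to\varphi)$. Monoidal t-norm based logic MTL has modus ponens as its only rule and the axiom schemata $(\varphi\to\psi)\to((\psi\to\chi)\to(\varphi\to\chi))$; $(\varphi\&\psi)\to\varphi$; $(\varphi\&\psi)\to(\psi\&\varphi)$; $(\varphi\wedge\psi)\to\varphi$; $(\varphi\wedge\psi)\to(\psi\wedge\varphi)$; $(\varphi\&(\varphi\to\psi))\to(\psi\wedge\varphi)$; $(\varphi\to(\psi\to\chi))\to((\varphi\&\psi)\to\chi)$; $((\varphi\&\psi)\to\chi)\to(\varphi\to(\psi\to\chi))$; $((\varphi\to\psi)\to\chi)\to(((\psi\to\varphi)\to\chi)\to\chi)$; $\bot\to\varphi$. An (axiomatic) extension $L$ of MTL is obtained by adding further axiom schemata; $\Gamma\vdash_L\varphi$ denotes derivability from a set $\Gamma$ of formulas. An MTL-algebra is an algebra $\langle A,*,\Rightarrow,\sqcap,\sqcup,0,1\rangle$ such that $\langle A,\sqcap,\sqcup,0,1\rangle$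 is a lattice with minimum $0$ and maximum $1$, $\langle A,*,1\rangle$ is a commutative monoid, $z*x\le y$ iff $z\le x\Rightarrow y$, and $(x\Rightarrow y)\sqcup(y\Rightarrow x)=1$, for all $x,y,z\in A$. Assignments interpret $\&,\wedge,\to,\bot$ by $*,\sqcap,\Rightarrow,0$; $\Gamma\models_A\varphi$ means that every assignment in $A$ giving all formulas of $\Gamma$ the value $1$ gives $\varphi$ the value $1$. An $L$-algebra is an MTL-algebra in which every added axiom of $L$ takes the value $1$ under every assignment; an $L$-chain is a totally ordered $L$-algebra (the one-element algebra is allowed). Embeddings are injective homomorphisms. \textbf{Properties.} \begin{itemize} \item The variety of $L$-algebras has the chain joint embedding property (CJEP) if for any two $L$-chains with more than one element there is an $L$-chain into which both embed. \item $L$ has the strong single chain completeness (SSCC) if there is an $L$-chain $A$ such that, for every set $\Gamma$ of formulas and every formula $\varphi$, $\Gamma\vdash_L\varphi$ iff $\Gamma\models_A\varphi$. \item $L$ is Halld\'en complete (HC) if for all formulas $\varphi,\psi$ with no variables in common, $\vdash_L\varphi\vee\psi$ implies $\vdash_L\varphi$ or $\vdash_L\psi$. \item $L$ has the deductive Maksimova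 variable separation property (DMVP) if for all sets of formulas $\Gamma\cup\{\varphi\}$ and $\Sigma\cup\{\psi\}$ with no variables in common, $\Gamma,\Sigma\vdash_L\varphi\vee\psi$ implies $\Gamma\vdash_L\varphi$ or $\Sigma\vdash_L\psi$. \item $L$ has the deductive pseudo-relevance property (DPRP) if for every set of formulas $\Gamma$ and every formula $\psi$ with no variables in common, $\Gamma\vdash_L\psi$ implies $\Gamma\vdash_L\bot$ or $\vdash_L\psi$. \item $L$ has the strong deductive pseudo-relevance property (SDPRP) if for all sets of formulas $\Gamma$ and $\Sigma\cup\{\psi\}$ with no variables in common, $\Gamma,\Sigma\vdash_L\psi$ implies $\Gamma\vdash_L\bot$ or $\Sigma\vdash_L\psi$. \end{itemize} \textbf{Theorem.} Let $L$ be an extension of MTL. \begin{itemize} \item If the variety of $L$-algebras has the CJEP, then $L$ has the SSCC, the HC, the DMVP and the SDPRP. \item If $L$ has the DMVP, then $L$ has the DPRP. \end{itemize} -/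

import Mathlib

universe u

namespace MTL

/-- Formulas over the primitive connectives `&`, `∧`, `→`, `⊥` and the variables `x₀, x₁, …`. -/
inductive Formula : Type
  | var (n : ℕ) : Formula
  | bot : Formula
  | conj (φ ψ : Formula) : Formula
  | meet (φ ψ : Formula) : Formula
  | imp (φ ψ : Formula) : Formula

namespace Formula

/-- The derived connective `φ ∨ ψ := ((φ → ψ) → ψ) ∧ ((ψ → φ) → φ)`. -/
def disj (φ ψ : Formula) : Formula :=
  meet (imp (imp φ ψ) ψ) (imp (imp ψ φ) φ)

/-- The set of variables occurring in a formula. -/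
def vars : Formula → Set ℕ
  | var n => {n}
  | bot => ∅
  | conj φ ψ => φ.vars ∪ ψ.vars
  | meet φ ψ => φ.vars ∪ ψ.vars
  | imp φ ψ => φ.vars ∪ ψ.vars

/-- Uniform substitution of formulas for variables. -/
def subst (σ : ℕ → Formula) : Formula → Formula
  | var n => σ n
  | bot => bot
  | conj φ ψ => conj (φ.subst σ) (ψ.subst σ)
  | meet φ ψ => meet (φ.subst σ) (ψ.subst σ)
  | imp φ ψ => imp (φ.subst σ) (ψ.subst σ)

end Formula

open Formula

/-- The set of variables occurring in a set of formulas. -/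
def varsOf (Γ : Set Formula) : Set ℕ := ⋃ φ ∈ Γ, φ.vars

/-- The axiom schemata of MTL. -/
inductive IsAxiom : Formula → Prop
  | a1 (φ ψ χ : Formula) : IsAxiom (imp (imp φ ψ) (imp (imp ψ χ) (imp φ χ)))
  | a2 (φ ψ : Formula) : IsAxiom (imp (conj φ ψ) φ)
  | a3 (φ ψ : Formula) : IsAxiom (imp (conj φ ψ) (conj ψ φ))
  | a4 (φ ψ : Formula) : IsAxiom (imp (meet φ ψ) φ)
  | a5 (φ ψ : Formula) : IsAxiom (imp (meet φ ψ) (meet ψ φ))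
  | a6 (φ ψ : Formula) : IsAxiom (imp (conj φ (imp φ ψ)) (meet ψ φ))
  | a7a (φ ψ χ : Formula) : IsAxiom (imp (imp φ (imp ψ χ)) (imp (conj φ ψ) χ))
  | a7b (φ ψ χ : Formula) : IsAxiom (imp (imp (conj φ ψ) χ) (imp φ (imp ψ χ)))
  | a8 (φ ψ χ : Formula) :
      IsAxiom (imp (imp (imp φ ψ) χ) (imp (imp (imp ψ φ) χ) χ))
  | a9 (φ : Formula) : IsAxiom (imp bot φ)

/-- `Provable L Γ φ` is `Γ ⊢_L φ`, where the axiomatic extension of MTL is presented by the set `L`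
of the added axioms, read as schemata: all their substitution instances are axioms.
The only rule is modus ponens. -/
inductive Provable (L : Set Formula) (Γ : Set Formula) : Formula → Prop
  | hyp {φ : Formula} : φ ∈ Γ → Provable L Γ φ
  | mtl {φ : Formula} : IsAxiom φ → Provable L Γ φ
  | ext {φ : Formula} (σ : ℕ → Formula) : φ ∈ L → Provable L Γ (φ.subst σ)
  | mp {φ ψ : Formula} : Provable L Γ φ → Provable L Γ (imp φ ψ) → Provable L Γ ψ

/-- MTL-algebras: bounded integral commutative residuated lattices with prelinearity.
The one-element algebra is allowed. -/
class MTLAlgebra (A : Type u) extends Lattice A, BoundedOrder A, CommMonoid A, HImp A where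
  one_eq_top : (1 : A) = ⊤
  residuation : ∀ x y z : A, z * x ≤ y ↔ z ≤ x ⇨ y
  prelinearity : ∀ x y : A, (x ⇨ y) ⊔ (y ⇨ x) = 1

/-- The value of a formula under an assignment `v` of its variables in an MTL-algebra. -/
def eval {A : Type u} [MTLAlgebra A] (v : ℕ → A) : Formula → A
  | var n => v n
  | bot => ⊥
  | conj φ ψ => eval v φ * eval v ψ
  | meet φ ψ => eval v φ ⊓ eval v ψ
  | imp φ ψ => eval v φ ⇨ eval v ψ

/-- `Γ ⊨_A φ`: every assignment in `A` that models `Γ` gives `φ` the value `1`. -/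
def Entails (A : Type u) [MTLAlgebra A] (Γ : Set Formula) (φ : Formula) : Prop :=
  ∀ v : ℕ → A, (∀ γ ∈ Γ, eval v γ = 1) → eval v φ = 1

/-- `A` belongs to the variety of `L`-algebras: all the added axioms are valid in `A`. -/
def IsLAlgebra (L : Set Formula) (A : Type u) [MTLAlgebra A] : Prop :=
  ∀ φ ∈ L, ∀ v : ℕ → A, eval v φ = 1

/-- `A` is an `L`-chain: a totally ordered `L`-algebra. -/
def IsLChain (L : Set Formula) (A : Type u) [MTLAlgebra A] : Prop :=
  IsLAlgebra L A ∧ ∀ x y : A, x ≤ y ∨ y ≤ x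

/-- Embeddings of MTL-algebras: injective homomorphisms for all the operations. -/
structure IsEmbedding {A B : Type u} [MTLAlgebra A] [MTLAlgebra B] (f : A → B) : Prop where
  injective : Function.Injective f
  map_mul : ∀ x y, f (x * y) = f x * f y
  map_himp : ∀ x y, f (x ⇨ y) = f x ⇨ f y
  map_inf : ∀ x y, f (x ⊓ y) = f x ⊓ f y
  map_sup : ∀ x y, f (x ⊔ y) = f x ⊔ f y
  map_bot : f ⊥ = ⊥
  map_one : f 1 = 1

/-- Chain joint embedding property: any two nontrivial `L`-chains embed into a common `L`-chain.
(The one-element chain embeds into no nontrivial algebra, as embeddings preserve `0` and `1`;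
so it has to be left out here.) -/
def CJEP (L : Set Formula) : Prop :=
  ∀ (A B : Type u) [MTLAlgebra A] [MTLAlgebra B] [Nontrivial A] [Nontrivial B],
    IsLChain L A → IsLChain L B →
      ∃ (C : Type u) (_ : MTLAlgebra C), IsLChain L C ∧
        (∃ f : A → C, IsEmbedding f) ∧ (∃ g : B → C, IsEmbedding g)

/-- Strong single chain completeness. -/
def SSCC (L : Set Formula) : Prop :=
  ∃ (A : Type u) (_ : MTLAlgebra A), IsLChain L A ∧
    ∀ (Γ : Set Formula) (φ : Formula), Provable L Γ φ ↔ Entails A Γ φ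

/-- Halldén completeness. -/
def HC (L : Set Formula) : Prop :=
  ∀ φ ψ : Formula, Disjoint φ.vars ψ.vars →
    Provable L ∅ (φ.disj ψ) → Provable L ∅ φ ∨ Provable L ∅ ψ

/-- Deductive Maksimova's variable separation property. -/
def DMVP (L : Set Formula) : Prop :=
  ∀ (Γ Δ : Set Formula) (φ ψ : Formula), Disjoint (varsOf (Γ ∪ {φ})) (varsOf (Δ ∪ {ψ})) →
    Provable L (Γ ∪ Δ) (φ.disj ψ) → Provable L Γ φ ∨ Provable L Δ ψ

/-- Deductive pseudo-relevance property. -/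
def DPRP (L : Set Formula) : Prop :=
  ∀ (Γ : Set Formula) (ψ : Formula), Disjoint (varsOf Γ) ψ.vars →
    Provable L Γ ψ → Provable L Γ bot ∨ Provable L ∅ ψ

/-- Strong deductive pseudo-relevance property. -/
def SDPRP (L : Set Formula) : Prop :=
  ∀ (Γ Δ : Set Formula) (ψ : Formula), Disjoint (varsOf Γ) (varsOf (Δ ∪ {ψ})) →
    Provable L (Γ ∪ Δ) ψ → Provable L Γ bot ∨ Provable L Δ ψ

end MTL

/-!
Consequence from any set of premises is complete for `L`-chains: if `Γ` does not prove `φ`, a filter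
of the Lindenbaum algebra of `Γ` that is maximal among those avoiding `φ` is prime by prelinearity,
so its quotient is a chain refuting the consequence.

The CJEP joins finitely many nontrivial `L`-chains in one `L`-chain, and an ultraproduct over the
finite subfamilies then joins an arbitrary family. Applied to one countermodel for each unprovable
consequence, this gives a single strongly complete chain. For the DMVP, put a countermodel of
`Γ ⊢ φ` and one of `Δ ⊢ ψ` in a common chain; as no variables are shared, the two assignments
combine into one, and in a chain a join is `1` only if one of its terms is. The HC is the DMVP with
`Γ = Δ = ∅`, the SDPRP is the DMVP with `φ = ⊥`, and the DPRP is the SDPRP with `Δ = ∅`.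
-/

namespace MTL

open Formula Filter

universe v

section Algebra

variable {A : Type*} [MTLAlgebra A]

theorem le_one (x : A) : x ≤ 1 :=
  le_top.trans_eq MTLAlgebra.one_eq_top.symm

theorem one_le_iff_eq_one {x : A} : 1 ≤ x ↔ x = 1 :=
  (le_one x).ge_iff_eq

theorem gc_mul_himp (x : A) : GaloisConnection (· * x) (x ⇨ ·) :=
  fun z y => MTLAlgebra.residuation x y z

instance : IsOrderedMonoid A where
  mul_le_mul_left _ _ h z := (gc_mul_himp z).monotone_l h

theorem mul_le_left (x y : A) : x * y ≤ x :=
  mul_le_of_le_one_right' (le_one y)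

theorem mul_le_right (x y : A) : x * y ≤ y :=
  mul_le_of_le_one_left' (le_one x)

theorem himp_mul_le (x y : A) : (x ⇨ y) * x ≤ y :=
  (gc_mul_himp x).l_u_le y

theorem himp_eq_one {x y : A} : x ⇨ y = 1 ↔ x ≤ y := by
  rw [← one_le_iff_eq_one, ← MTLAlgebra.residuation, one_mul]

theorem one_himp (x : A) : 1 ⇨ x = x :=
  eq_of_forall_le_iff fun z => by rw [← MTLAlgebra.residuation, mul_one]

theorem himp_himp_eq_mul_himp (x y z : A) : x ⇨ y ⇨ z = x * y ⇨ z :=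
  eq_of_forall_le_iff fun w => by simp only [← MTLAlgebra.residuation, mul_assoc]

theorem himp_mul_himp_le (x y z : A) : (x ⇨ y) * (y ⇨ z) ≤ x ⇨ z := by
  rw [← MTLAlgebra.residuation]
  calc (x ⇨ y) * (y ⇨ z) * x = (y ⇨ z) * ((x ⇨ y) * x) := by ac_rfl
    _ ≤ (y ⇨ z) * y := by gcongr; exact himp_mul_le x y
    _ ≤ z := himp_mul_le y z

theorem mul_sup (x y z : A) : x * (y ⊔ z) = x * y ⊔ x * z := by
  simpa only [mul_comm x] using (gc_mul_himp x).l_sup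

theorem le_of_mul_le_of_mul_le {x y z w : A} (h : x ⊔ y = 1) (hx : z * x ≤ w) (hy : z * y ≤ w) :
    z ≤ w :=
  calc z = z * x ⊔ z * y := by rw [← mul_sup, h, mul_one]
    _ ≤ w := sup_le hx hy

theorem sup_mul_eq_one {x y z : A} (hy : x ⊔ y = 1) (hz : x ⊔ z = 1) : x ⊔ y * z = 1 := by
  rw [← one_le_iff_eq_one]
  calc 1 = x ⊔ (y * x ⊔ y * z) := by rw [← mul_sup, hz, mul_one, hy]
    _ ≤ x ⊔ y * z := sup_le le_sup_left (sup_le_sup_right (mul_le_right y x) _)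

theorem sup_pow_eq_one {x y : A} (h : x ⊔ y = 1) (n : ℕ) : x ⊔ y ^ n = 1 := by
  induction n with
  | zero => rw [pow_zero, sup_eq_right.2 (le_one x)]
  | succ n ih => rw [pow_succ]; exact sup_mul_eq_one ih h

theorem pow_sup_pow_eq_one {x y : A} (h : x ⊔ y = 1) (m n : ℕ) : x ^ m ⊔ y ^ n = 1 := by
  rw [sup_comm]
  exact sup_pow_eq_one (sup_comm x _ ▸ sup_pow_eq_one h n) m

theorem eq_one_or_eq_one_of_sup_eq_one {x y : A} (hxy : x ≤ y ∨ y ≤ x) (h : x ⊔ y = 1) :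
    x = 1 ∨ y = 1 :=
  hxy.symm.imp (fun hyx => (sup_eq_left.2 hyx).symm.trans h)
    (fun hxy => (sup_eq_right.2 hxy).symm.trans h)

theorem himp_himp_inf_himp_himp (x y : A) : ((x ⇨ y) ⇨ y) ⊓ ((y ⇨ x) ⇨ x) = x ⊔ y := by
  have le_himp_himp (x y : A) : x ≤ (x ⇨ y) ⇨ y := by
    rw [← MTLAlgebra.residuation, mul_comm]
    exact himp_mul_le x y
  have le_himp (x y : A) : y ≤ x ⇨ y := (MTLAlgebra.residuation x y y).1 (mul_le_left y x)
  refine le_antisymm ?_ (sup_le (le_inf (le_himp_himp x y) (le_himp _ x))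
    (le_inf (le_himp _ y) (le_himp_himp y x)))
  refine le_of_mul_le_of_mul_le (MTLAlgebra.prelinearity x y) ?_ ?_
  · exact ((MTLAlgebra.residuation _ _ _).2 inf_le_left).trans le_sup_right
  · exact ((MTLAlgebra.residuation _ _ _).2 inf_le_right).trans le_sup_left

end Algebra

section Evaluation

variable {A : Type*} [MTLAlgebra A]

/-- A map from formulas to an MTL-algebra that commutes with the primitive connectives; these are
the maps of the form `eval v`. -/
structure IsEvaluation (e : Formula → A) : Prop where
  map_bot : e bot = ⊥
  map_conj : ∀ φ ψ, e (conj φ ψ) = e φ * e ψ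
  map_meet : ∀ φ ψ, e (meet φ ψ) = e φ ⊓ e ψ
  map_imp : ∀ φ ψ, e (imp φ ψ) = e φ ⇨ e ψ

theorem IsEvaluation.eq_eval {e : Formula → A} (he : IsEvaluation e) (φ : Formula) :
    e φ = eval (fun n => e (var n)) φ := by
  induction φ with
  | var n => rfl
  | bot => exact he.map_bot
  | conj φ ψ ihφ ihψ => rw [he.map_conj, ihφ, ihψ, eval]
  | meet φ ψ ihφ ihψ => rw [he.map_meet, ihφ, ihψ, eval]
  | imp φ ψ ihφ ihψ => rw [he.map_imp, ihφ, ihψ, eval]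

theorem eval_subst (v : ℕ → A) (σ : ℕ → Formula) (φ : Formula) :
    eval v (φ.subst σ) = eval (fun n => eval v (σ n)) φ :=
  IsEvaluation.eq_eval (e := fun φ => eval v (φ.subst σ))
    ⟨rfl, fun _ _ => rfl, fun _ _ => rfl, fun _ _ => rfl⟩ φ

theorem eval_congr {v w : ℕ → A} {φ : Formula} (h : Set.EqOn v w φ.vars) :
    eval v φ = eval w φ := by
  induction φ with
  | var n => exact h rfl
  | bot => rfl
  | conj φ ψ ihφ ihψ | meet φ ψ ihφ ihψ | imp φ ψ ihφ ihψ =>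
    simp only [eval, ihφ (h.mono Set.subset_union_left), ihψ (h.mono Set.subset_union_right)]

theorem eval_eq_one_of_isAxiom {φ : Formula} (h : IsAxiom φ) (v : ℕ → A) : eval v φ = 1 := by
  cases h with
  | a1 φ ψ χ =>
    exact himp_eq_one.2 ((MTLAlgebra.residuation _ _ _).1 (himp_mul_himp_le _ _ _))
  | a2 φ ψ => exact himp_eq_one.2 (mul_le_left _ _)
  | a3 φ ψ => exact himp_eq_one.2 (mul_comm _ _).le
  | a4 φ ψ => exact himp_eq_one.2 inf_le_left
  | a5 φ ψ => exact himp_eq_one.2 (inf_comm _ _).le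
  | a6 φ ψ =>
    exact himp_eq_one.2 (le_inf ((mul_comm _ _).trans_le (himp_mul_le _ _)) (mul_le_left _ _))
  | a7a φ ψ χ => exact himp_eq_one.2 (himp_himp_eq_mul_himp _ _ _).le
  | a7b φ ψ χ => exact himp_eq_one.2 (himp_himp_eq_mul_himp _ _ _).ge
  | a8 φ ψ χ =>
    refine himp_eq_one.2 ((MTLAlgebra.residuation _ _ _).1 ?_)
    refine le_of_mul_le_of_mul_le (MTLAlgebra.prelinearity (eval v φ) (eval v ψ)) ?_ ?_
    · exact (mul_le_mul_left (mul_le_left _ _) _).trans (himp_mul_le _ _)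
    · exact (mul_le_mul_left (mul_le_right _ _) _).trans (himp_mul_le _ _)
  | a9 φ => exact himp_eq_one.2 bot_le

theorem Provable.entails {L Γ : Set Formula} {φ : Formula} (h : Provable L Γ φ)
    (hA : IsLAlgebra L A) : Entails A Γ φ := by
  intro v hv
  induction h with
  | hyp h => exact hv _ h
  | mtl h => exact eval_eq_one_of_isAxiom h v
  | ext σ h => rw [eval_subst]; exact hA _ h _
  | mp _ _ ihφ ihimp => rwa [eval, ihφ, one_himp] at ihimp

theorem eval_disj (v : ℕ → A) (φ ψ : Formula) : eval v (φ.disj ψ) = eval v φ ⊔ eval v ψ :=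
  himp_himp_inf_himp_himp _ _

end Evaluation

section Embedding

variable {A B C : Type u} [MTLAlgebra A] [MTLAlgebra B] [MTLAlgebra C]

theorem IsEmbedding.eval_eq_one_iff {f : A → B} (hf : IsEmbedding f) (v : ℕ → A) (φ : Formula) :
    eval (fun n => f (v n)) φ = 1 ↔ eval v φ = 1 := by
  have hfv : IsEvaluation fun φ => f (eval v φ) :=
    ⟨hf.map_bot, fun _ _ => hf.map_mul _ _, fun _ _ => hf.map_inf _ _, fun _ _ => hf.map_himp _ _⟩
  rw [← hf.injective.eq_iff, hf.map_one]
  exact (hfv.eq_eval φ).congr_left.symm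

theorem IsEmbedding.comp {g : B → C} {f : A → B} (hg : IsEmbedding g) (hf : IsEmbedding f) :
    IsEmbedding (g ∘ f) where
  injective := hg.injective.comp hf.injective
  map_mul x y := by simp only [Function.comp_apply, hf.map_mul, hg.map_mul]
  map_himp x y := by simp only [Function.comp_apply, hf.map_himp, hg.map_himp]
  map_inf x y := by simp only [Function.comp_apply, hf.map_inf, hg.map_inf]
  map_sup x y := by simp only [Function.comp_apply, hf.map_sup, hg.map_sup]
  map_bot := by simp only [Function.comp_apply, hf.map_bot, hg.map_bot]
  map_one := by simp only [Function.comp_apply, hf.map_one, hg.map_one]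

end Embedding

section Preorder

/-- A preorder `r` that satisfies the laws of an MTL-algebra up to equivalence, so that its
antisymmetrization is an MTL-algebra. The relation is explicit because it need not be the order `≤`
that `X` may already have. -/
class IsMTLPreorder {X : Type*} [Mul X] [One X] [Min X] [Max X] [HImp X] [Bot X]
    (r : X → X → Prop) : Prop extends IsPreorder X r where
  inf_le_left : ∀ x y, r (x ⊓ y) x
  inf_le_right : ∀ x y, r (x ⊓ y) y
  le_inf : ∀ {x y z}, r x y → r x z → r x (y ⊓ z)
  le_sup_left : ∀ x y, r x (x ⊔ y)
  le_sup_right : ∀ x y, r y (x ⊔ y)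
  sup_le : ∀ {x y z}, r x z → r y z → r (x ⊔ y) z
  bot_le : ∀ x, r ⊥ x
  le_one : ∀ x, r x 1
  mul_comm : ∀ x y, r (x * y) (y * x)
  mul_assoc : ∀ x y z, r (x * y * z) (x * (y * z))
  mul_one_le : ∀ x, r (x * 1) x
  le_mul_one : ∀ x, r x (x * 1)
  residuation : ∀ x y z, r (z * x) y ↔ r z (x ⇨ y)
  prelinearity : ∀ x y, r 1 ((x ⇨ y) ⊔ (y ⇨ x))

namespace IsMTLPreorder

variable {X : Type*} [Mul X] [One X] [Min X] [Max X] [HImp X] [Bot X] {r : X → X → Prop}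
  [IsMTLPreorder r] {x x' y y' : X}

theorem mul_le_mul_right (h : r x x') (y : X) : r (x * y) (x' * y) :=
  (residuation _ _ _).2 (trans_of r h ((residuation _ _ _).1 (refl_of r _)))

theorem mul_le_mul (h : r x x') (h' : r y y') : r (x * y) (x' * y') :=
  trans_of r (mul_le_mul_right h y) <| trans_of r (mul_comm _ _) <|
    trans_of r (mul_le_mul_right h' x') (mul_comm _ _)

theorem himp_le_himp (h : r x' x) (h' : r y y') : r (x ⇨ y) (x' ⇨ y') :=
  (residuation _ _ _).1 <| trans_of r (mul_le_mul (refl_of r _) h) <|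
    trans_of r ((residuation _ _ _).2 (refl_of r _)) h'

theorem inf_le_inf (h : r x x') (h' : r y y') : r (x ⊓ y) (x' ⊓ y') :=
  le_inf (trans_of r (inf_le_left _ _) h) (trans_of r (inf_le_right _ _) h')

theorem sup_le_sup (h : r x x') (h' : r y y') : r (x ⊔ y) (x' ⊔ y') :=
  sup_le (trans_of r h (le_sup_left _ _)) (trans_of r h' (le_sup_right _ _))

theorem mul_assoc_symm (x y z : X) : r (x * (y * z)) (x * y * z) :=
  have rotate (x y z : X) : r (x * (y * z)) (y * z * x) := mul_comm _ _
  trans_of r (rotate x y z) <| trans_of r (mul_assoc y z x) <|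
    trans_of r (rotate y z x) <| trans_of r (mul_assoc z x y) (mul_comm _ _)

end IsMTLPreorder

open IsMTLPreorder

variable {X : Type*} [Mul X] [One X] [Min X] [Max X] [HImp X] [Bot X] {r : X → X → Prop}
  [IsMTLPreorder r] {x y : X}

theorem toAntisymmetrization_eq_iff :
    toAntisymmetrization r x = toAntisymmetrization r y ↔ AntisymmRel r x y :=
  Quotient.eq

instance : MTLAlgebra (Antisymmetrization X r) where
  le := Quotient.lift₂ r fun _ _ _ _ h h' => propext
    ⟨fun hr => trans_of r (trans_of r h.2 hr) h'.1,
      fun hr => trans_of r (trans_of r h.1 hr) h'.2⟩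
  mul := Quotient.map₂ (· * ·)
    fun _ _ h _ _ h' => ⟨mul_le_mul h.1 h'.1, mul_le_mul h.2 h'.2⟩
  himp := Quotient.map₂ (· ⇨ ·)
    fun _ _ h _ _ h' => ⟨himp_le_himp h.2 h'.1, himp_le_himp h.1 h'.2⟩
  inf := Quotient.map₂ (· ⊓ ·)
    fun _ _ h _ _ h' => ⟨inf_le_inf h.1 h'.1, inf_le_inf h.2 h'.2⟩
  sup := Quotient.map₂ (· ⊔ ·)
    fun _ _ h _ _ h' => ⟨sup_le_sup h.1 h'.1, sup_le_sup h.2 h'.2⟩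
  one := toAntisymmetrization r 1
  top := toAntisymmetrization r 1
  bot := toAntisymmetrization r ⊥
  le_refl := by rintro ⟨x⟩; exact refl_of r x
  le_trans := by rintro ⟨x⟩ ⟨y⟩ ⟨z⟩; exact trans_of r
  le_antisymm := by rintro ⟨x⟩ ⟨y⟩ h h'; exact Quotient.sound ⟨h, h'⟩
  inf_le_left := by rintro ⟨x⟩ ⟨y⟩; exact IsMTLPreorder.inf_le_left x y
  inf_le_right := by rintro ⟨x⟩ ⟨y⟩; exact IsMTLPreorder.inf_le_right x y
  le_inf := by rintro ⟨x⟩ ⟨y⟩ ⟨z⟩; exact IsMTLPreorder.le_inf (r := r)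
  le_sup_left := by rintro ⟨x⟩ ⟨y⟩; exact IsMTLPreorder.le_sup_left x y
  le_sup_right := by rintro ⟨x⟩ ⟨y⟩; exact IsMTLPreorder.le_sup_right x y
  sup_le := by rintro ⟨x⟩ ⟨y⟩ ⟨z⟩; exact IsMTLPreorder.sup_le (r := r)
  le_top := by rintro ⟨x⟩; exact IsMTLPreorder.le_one x
  bot_le := by rintro ⟨x⟩; exact IsMTLPreorder.bot_le x
  mul_comm := by rintro ⟨x⟩ ⟨y⟩; exact Quotient.sound ⟨mul_comm x y, mul_comm y x⟩
  mul_assoc := by rintro ⟨x⟩ ⟨y⟩ ⟨z⟩; exact Quotient.sound ⟨mul_assoc x y z, mul_assoc_symm x y z⟩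
  one_mul := by
    rintro ⟨x⟩
    exact Quotient.sound
      ⟨trans_of r (mul_comm 1 x) (mul_one_le x), trans_of r (le_mul_one x) (mul_comm x 1)⟩
  mul_one := by rintro ⟨x⟩; exact Quotient.sound ⟨mul_one_le x, le_mul_one x⟩
  one_eq_top := rfl
  residuation := by rintro ⟨x⟩ ⟨y⟩ ⟨z⟩; exact IsMTLPreorder.residuation x y z
  prelinearity := by
    rintro ⟨x⟩ ⟨y⟩
    exact Quotient.sound ⟨IsMTLPreorder.le_one _, IsMTLPreorder.prelinearity x y⟩

theorem toAntisymmetrization_eq_one_iff : toAntisymmetrization r x = 1 ↔ r 1 x :=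
  toAntisymmetrization_eq_iff.trans (and_iff_right (IsMTLPreorder.le_one x))

end Preorder

section Lindenbaum

namespace Provable

variable {L Γ : Set Formula} {φ ψ χ : Formula}

theorem imp_trans (h : Provable L Γ (imp φ ψ)) (h' : Provable L Γ (imp ψ χ)) :
    Provable L Γ (imp φ χ) :=
  mp h' (mp h (mtl (.a1 _ _ _)))

theorem curry (h : Provable L Γ (imp (conj φ ψ) χ)) : Provable L Γ (imp φ (imp ψ χ)) :=
  mp h (mtl (.a7b _ _ _))

theorem uncurry (h : Provable L Γ (imp φ (imp ψ χ))) : Provable L Γ (imp (conj φ ψ) χ) :=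
  mp h (mtl (.a7a _ _ _))

theorem imp_swap (h : Provable L Γ (imp φ (imp ψ χ))) : Provable L Γ (imp ψ (imp φ χ)) :=
  curry (imp_trans (mtl (.a3 _ _)) (uncurry h))

theorem imp_imp_left (φ ψ : Formula) : Provable L Γ (imp φ (imp ψ φ)) :=
  curry (mtl (.a2 _ _))

theorem imp_of (ψ : Formula) (h : Provable L Γ φ) : Provable L Γ (imp ψ φ) :=
  mp h (imp_imp_left φ ψ)

theorem imp_self (φ : Formula) : Provable L Γ (imp φ φ) :=
  mp (mtl (.a9 φ)) (imp_swap (imp_imp_left φ (imp bot φ)))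

theorem imp_imp_imp (φ ψ : Formula) : Provable L Γ (imp φ (imp (imp φ ψ) ψ)) :=
  imp_swap (imp_self _)

theorem cases_imp (h : Provable L Γ (imp (imp φ ψ) χ)) (h' : Provable L Γ (imp (imp ψ φ) χ)) :
    Provable L Γ χ :=
  mp h' (mp h (mtl (.a8 _ _ _)))

theorem meet_imp_right (φ ψ : Formula) : Provable L Γ (imp (meet φ ψ) ψ) :=
  imp_trans (mtl (.a5 _ _)) (mtl (.a4 _ _))

theorem imp_imp_meet_left (φ ψ : Formula) : Provable L Γ (imp φ (imp (imp φ ψ) (meet φ ψ))) :=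
  curry (imp_trans (mtl (.a6 φ ψ)) (mtl (.a5 ψ φ)))

theorem imp_imp_meet_right (φ ψ : Formula) : Provable L Γ (imp ψ (imp (imp ψ φ) (meet φ ψ))) :=
  curry (mtl (.a6 ψ φ))

theorem imp_meet (h : Provable L Γ (imp χ φ)) (h' : Provable L Γ (imp χ ψ)) :
    Provable L Γ (imp χ (meet φ ψ)) :=
  cases_imp (imp_swap (imp_trans h (imp_imp_meet_left φ ψ)))
    (imp_swap (imp_trans h' (imp_imp_meet_right φ ψ)))

theorem imp_disj_left (φ ψ : Formula) : Provable L Γ (imp φ (disj φ ψ)) :=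
  imp_meet (imp_imp_imp φ ψ) (imp_imp_left φ _)

theorem imp_disj_right (φ ψ : Formula) : Provable L Γ (imp ψ (disj φ ψ)) :=
  imp_meet (imp_imp_left ψ _) (imp_imp_imp ψ φ)

theorem disj_imp (h : Provable L Γ (imp φ χ)) (h' : Provable L Γ (imp ψ χ)) :
    Provable L Γ (imp (disj φ ψ) χ) :=
  have disj_imp_imp_right : Provable L Γ (imp (disj φ ψ) (imp (imp φ ψ) ψ)) := mtl (.a4 _ _)
  have disj_imp_imp_left : Provable L Γ (imp (disj φ ψ) (imp (imp ψ φ) φ)) := meet_imp_right _ _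
  cases_imp (imp_swap (curry (imp_trans (uncurry disj_imp_imp_right) h')))
    (imp_swap (curry (imp_trans (uncurry disj_imp_imp_left) h)))

theorem conj_assoc (φ ψ χ : Formula) :
    Provable L Γ (imp (conj (conj φ ψ) χ) (conj φ (conj ψ χ))) :=
  uncurry (uncurry (imp_trans (curry (imp_self _)) (mtl (.a7b _ _ _))))

end Provable

instance : Mul Formula := ⟨conj⟩
instance : One Formula := ⟨imp bot bot⟩
instance : Min Formula := ⟨meet⟩
instance : Max Formula := ⟨disj⟩
instance : HImp Formula := ⟨imp⟩
instance : Bot Formula := ⟨bot⟩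

/-- The preorder of formulas by provable implication from `Γ`. -/
def ProvableImp (L Γ : Set Formula) (φ ψ : Formula) : Prop :=
  Provable L Γ (imp φ ψ)

variable (L Γ : Set Formula)

instance : IsMTLPreorder (ProvableImp L Γ) where
  refl := .imp_self
  trans _ _ _ := .imp_trans
  inf_le_left _ _ := .mtl (.a4 _ _)
  inf_le_right := .meet_imp_right
  le_inf := .imp_meet
  le_sup_left := .imp_disj_left
  le_sup_right := .imp_disj_right
  sup_le := .disj_imp
  bot_le _ := .mtl (.a9 _)
  le_one _ := .imp_of _ (.imp_self bot)
  mul_comm _ _ := .mtl (.a3 _ _)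
  mul_assoc := .conj_assoc
  mul_one_le _ := .mtl (.a2 _ _)
  le_mul_one _ := .mp (.imp_self bot) (.imp_swap (.curry (.imp_self _)))
  residuation _ _ _ := ⟨.curry, .uncurry⟩
  prelinearity _ _ := .imp_of _ (.cases_imp (.imp_disj_left _ _) (.imp_disj_right _ _))

/-- The Lindenbaum algebra of the theory axiomatized by `Γ`. -/
abbrev Lindenbaum : Type :=
  Antisymmetrization Formula (ProvableImp L Γ)

namespace Lindenbaum

/-- The class of a formula in the Lindenbaum algebra. -/
abbrev mk (φ : Formula) : Lindenbaum L Γ :=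
  toAntisymmetrization (ProvableImp L Γ) φ

theorem mk_eq_one_iff (φ : Formula) : mk L Γ φ = 1 ↔ Provable L Γ φ :=
  toAntisymmetrization_eq_one_iff.trans ⟨.mp (.imp_self bot), .imp_of _⟩

theorem eval_mk_var (φ : Formula) : eval (fun n => mk L Γ (var n)) φ = mk L Γ φ :=
  (IsEvaluation.eq_eval (e := mk L Γ) ⟨rfl, fun _ _ => rfl, fun _ _ => rfl, fun _ _ => rfl⟩ φ).symm

theorem isLAlgebra : IsLAlgebra L (Lindenbaum L Γ) := by
  intro φ hφ v
  obtain ⟨σ, rfl⟩ := Quotient.mk_surjective.comp_left v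
  calc eval (fun n => mk L Γ (σ n)) φ = eval (fun n => mk L Γ (var n)) (φ.subst σ) := by
        simp only [eval_subst, eval_mk_var]
    _ = mk L Γ (φ.subst σ) := eval_mk_var L Γ _
    _ = 1 := (mk_eq_one_iff L Γ _).2 (.ext σ hφ)

end Lindenbaum

end Lindenbaum

section Quotient

/-- Filters of an MTL-algebra: the upward closed submonoids. -/
structure MTLFilter (A : Type*) [MTLAlgebra A] extends Submonoid A where
  isUpperSet' : IsUpperSet carrier

namespace MTLFilter

variable {A : Type*} [MTLAlgebra A]

instance : SetLike (MTLFilter A) A where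
  coe F := F.carrier
  coe_injective := by rintro ⟨F, _⟩ ⟨G, _⟩ h; congr; exact SetLike.coe_injective h

instance : SubmonoidClass (MTLFilter A) A where
  mul_mem {F} := F.mul_mem'
  one_mem F := F.one_mem'

variable (F : MTLFilter A) {x y : A}

theorem isUpperSet : IsUpperSet (F : Set A) :=
  F.isUpperSet'

/-- The preorder defined by a filter, whose antisymmetrization is the quotient algebra. -/
def rel (x y : A) : Prop :=
  x ⇨ y ∈ F

variable {F}

theorem rel_iff_exists_mul_le : F.rel x y ↔ ∃ f ∈ F, f * x ≤ y :=
  ⟨fun h => ⟨x ⇨ y, h, himp_mul_le x y⟩,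
    fun ⟨f, hf, h⟩ => F.isUpperSet ((MTLAlgebra.residuation x y f).1 h) hf⟩

theorem rel_of_le (h : x ≤ y) : F.rel x y :=
  rel_iff_exists_mul_le.2 ⟨1, one_mem F, by rwa [one_mul]⟩

instance : IsMTLPreorder F.rel where
  refl x := rel_of_le le_rfl
  trans x y z hxy hyz := F.isUpperSet (himp_mul_himp_le x y z) (mul_mem hxy hyz)
  inf_le_left _ _ := rel_of_le inf_le_left
  inf_le_right _ _ := rel_of_le inf_le_right
  le_inf {x y z} hxy hxz := by
    obtain ⟨f, hf, hy⟩ := rel_iff_exists_mul_le.1 hxy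
    obtain ⟨g, hg, hz⟩ := rel_iff_exists_mul_le.1 hxz
    refine rel_iff_exists_mul_le.2 ⟨f * g, mul_mem hf hg, le_inf ?_ ?_⟩
    · exact (mul_le_mul_left (mul_le_left f g) x).trans hy
    · exact (mul_le_mul_left (mul_le_right f g) x).trans hz
  le_sup_left _ _ := rel_of_le le_sup_left
  le_sup_right _ _ := rel_of_le le_sup_right
  sup_le {x y z} hxz hyz := by
    obtain ⟨f, hf, hx⟩ := rel_iff_exists_mul_le.1 hxz
    obtain ⟨g, hg, hy⟩ := rel_iff_exists_mul_le.1 hyz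
    refine rel_iff_exists_mul_le.2 ⟨f * g, mul_mem hf hg, ?_⟩
    rw [mul_sup]
    refine sup_le ?_ ?_
    · exact (mul_le_mul_left (mul_le_left f g) x).trans hx
    · exact (mul_le_mul_left (mul_le_right f g) y).trans hy
  bot_le _ := rel_of_le bot_le
  le_one x := rel_of_le (MTL.le_one x)
  mul_comm x y := rel_of_le (_root_.mul_comm x y).le
  mul_assoc x y z := rel_of_le (_root_.mul_assoc x y z).le
  mul_one_le x := rel_of_le (mul_one x).le
  le_mul_one x := rel_of_le (mul_one x).ge
  residuation x y z := by rw [rel, rel, himp_himp_eq_mul_himp]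
  prelinearity x y := rel_of_le (MTLAlgebra.prelinearity x y).ge

variable (F)

/-- The quotient of an MTL-algebra by a filter. -/
abbrev Quotient : Type _ :=
  Antisymmetrization A F.rel

/-- The projection to the quotient algebra. -/
abbrev toQuotient (x : A) : F.Quotient :=
  toAntisymmetrization F.rel x

theorem toQuotient_eq_one_iff : F.toQuotient x = 1 ↔ x ∈ F := by
  rw [toAntisymmetrization_eq_one_iff, rel, one_himp]

theorem eval_toQuotient (v : ℕ → A) (φ : Formula) :
    eval (fun n => F.toQuotient (v n)) φ = F.toQuotient (eval v φ) :=
  (IsEvaluation.eq_eval (e := fun φ => F.toQuotient (eval v φ))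
    ⟨rfl, fun _ _ => rfl, fun _ _ => rfl, fun _ _ => rfl⟩ φ).symm

theorem isLAlgebra_quotient {L : Set Formula} (hA : IsLAlgebra L A) : IsLAlgebra L F.Quotient := by
  intro φ hφ v
  obtain ⟨w, rfl⟩ := Quotient.mk_surjective.comp_left v
  calc eval (fun n => F.toQuotient (w n)) φ = F.toQuotient (eval w φ) := F.eval_toQuotient w φ
    _ = 1 := congrArg F.toQuotient (hA φ hφ w)

/-- Prime filters, in the form that makes the quotient totally ordered. -/
def IsPrime : Prop :=
  ∀ x y, F.rel x y ∨ F.rel y x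

variable {F}

theorem IsPrime.isLChain_quotient {L : Set Formula} (hF : F.IsPrime) (hA : IsLAlgebra L A) :
    IsLChain L F.Quotient :=
  ⟨F.isLAlgebra_quotient hA, by rintro ⟨x⟩ ⟨y⟩; exact hF x y⟩

end MTLFilter

theorem exists_maximal_submonoid_forall_not_le {A : Type*} [MulOneClass A] [LE A] {a : A}
    (ha : ¬ 1 ≤ a) : ∃ M : Submonoid A, Maximal (fun M => ∀ x ∈ M, ¬ x ≤ a) M := by
  have bot_avoids : ∀ x ∈ (⊥ : Submonoid A), ¬ x ≤ a := by
    rintro x rfl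
    exact ha
  refine (zorn_le_nonempty₀ {M : Submonoid A | ∀ x ∈ M, ¬ x ≤ a}
    (fun c hc hchain N hN => ⟨sSup c, fun x hx => ?_, fun _ => le_sSup⟩) ⊥ bot_avoids).imp
    fun M hM => hM.2
  obtain ⟨K, hK, hxK⟩ := (Submonoid.mem_sSup_of_directedOn ⟨N, hN⟩ hchain.directedOn).1 hx
  exact hc hK x hxK

theorem exists_mul_pow_le_of_maximal {A : Type*} [CommMonoid A] [LE A] {a : A} {M : Submonoid A}
    (hM : Maximal (fun M => ∀ x ∈ M, ¬ x ≤ a) M) {x : A} (hx : x ∉ M) :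
    ∃ m ∈ M, ∃ n : ℕ, m * x ^ n ≤ a := by
  by_contra! h
  refine hx (hM.le_of_ge (y := M ⊔ Submonoid.powers x) ?_ le_sup_left
    (le_sup_right (a := M) (Submonoid.mem_powers x)))
  intro z hz
  obtain ⟨m, hm, _, ⟨n, rfl⟩, rfl⟩ := Submonoid.mem_sup.1 hz
  exact h m hm n

theorem exists_isPrime_notMem {A : Type*} [MTLAlgebra A] {a : A} (ha : a ≠ 1) :
    ∃ F : MTLFilter A, F.IsPrime ∧ a ∉ F := by
  obtain ⟨M, hM⟩ := exists_maximal_submonoid_forall_not_le (mt one_le_iff_eq_one.1 ha)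
  have upper : IsUpperSet (M : Set A) := by
    intro x y hxy hx
    by_contra hy
    obtain ⟨m, hm, n, hmn⟩ := exists_mul_pow_le_of_maximal hM hy
    exact hM.prop _ (mul_mem hm (pow_mem hx n)) (hmn.trans' (by gcongr))
  refine ⟨⟨M, upper⟩, fun x y => ?_, fun h => hM.prop a h le_rfl⟩
  by_contra! h
  obtain ⟨f, hf, m, hm⟩ := exists_mul_pow_le_of_maximal hM h.1
  obtain ⟨g, hg, n, hn⟩ := exists_mul_pow_le_of_maximal hM h.2
  refine hM.prop _ (mul_mem hf hg) (le_of_mul_le_of_mul_le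
    (pow_sup_pow_eq_one (MTLAlgebra.prelinearity x y) m n) ?_ ?_)
  · exact (mul_le_mul_left (mul_le_left f g) _).trans hm
  · exact (mul_le_mul_left (mul_le_right f g) _).trans hn

end Quotient

section Product

variable {I : Type*} {C : I → Type*} [∀ i, MTLAlgebra (C i)] {L : Set Formula}

instance : MTLAlgebra (∀ i, C i) where
  __ := Pi.instBoundedOrder
  __ := Pi.commMonoid
  himp x y i := x i ⇨ y i
  one_eq_top := funext fun _ => MTLAlgebra.one_eq_top
  residuation _ _ _ := forall_congr' fun _ => MTLAlgebra.residuation _ _ _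
  prelinearity _ _ := funext fun _ => MTLAlgebra.prelinearity _ _

theorem eval_apply (v : ℕ → ∀ i, C i) (φ : Formula) (i : I) :
    eval v φ i = eval (fun n => v n i) φ :=
  IsEvaluation.eq_eval (e := fun φ => eval v φ i)
    ⟨rfl, fun _ _ => rfl, fun _ _ => rfl, fun _ _ => rfl⟩ φ

theorem isLAlgebra_pi (hC : ∀ i, IsLAlgebra L (C i)) : IsLAlgebra L (∀ i, C i) :=
  fun φ hφ v => funext fun i => (eval_apply v φ i).trans (hC i φ hφ _)

variable (C)

/-- The filter of a product of MTL-algebras whose quotient is the reduced product along `l`. -/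
def reductionFilter (l : Filter I) : MTLFilter (∀ i, C i) where
  carrier := {x | ∀ᶠ i in l, x i = 1}
  one_mem' := .of_forall fun _ => rfl
  mul_mem' hx hy := by
    filter_upwards [hx, hy] with i hxi hyi
    rw [Pi.mul_apply, hxi, hyi, mul_one]
  isUpperSet' x y hxy hx := by
    filter_upwards [hx] with i hxi
    exact one_le_iff_eq_one.1 (hxi.ge.trans (hxy i))

variable {C}

theorem reductionFilter_rel_iff {l : Filter I} {x y : ∀ i, C i} :
    (reductionFilter C l).rel x y ↔ ∀ᶠ i in l, x i ≤ y i :=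
  eventually_congr (.of_forall fun _ => himp_eq_one)

theorem toQuotient_reductionFilter_eq_iff {l : Filter I} {x y : ∀ i, C i} :
    (reductionFilter C l).toQuotient x = (reductionFilter C l).toQuotient y ↔
      ∀ᶠ i in l, x i = y i := by
  rw [toAntisymmetrization_eq_iff, AntisymmRel, reductionFilter_rel_iff, reductionFilter_rel_iff]
  simp only [← eventually_and, le_antisymm_iff]

theorem isPrime_reductionFilter (U : Ultrafilter I) (hC : ∀ i (x y : C i), x ≤ y ∨ y ≤ x) :
    (reductionFilter C (U : Filter I)).IsPrime := fun x y => by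
  simp only [reductionFilter_rel_iff, ← Ultrafilter.eventually_or]
  exact .of_forall fun i => hC i (x i) (y i)

theorem isLChain_ultraproduct (U : Ultrafilter I) (hC : ∀ i, IsLChain L (C i)) :
    IsLChain L (reductionFilter C (U : Filter I)).Quotient :=
  (isPrime_reductionFilter U fun i => (hC i).2).isLChain_quotient
    (isLAlgebra_pi fun i => (hC i).1)

end Product

theorem isEmbedding_reducedProduct {I : Type v} {A : Type (max u v)} [MTLAlgebra A]
    {C : I → Type (max u v)} [∀ i, MTLAlgebra (C i)] {l : Filter I} [l.NeBot] {f : ∀ i, A → C i}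
    (hf : ∀ᶠ i in l, IsEmbedding (f i)) :
    IsEmbedding fun a => (reductionFilter C l).toQuotient fun i => f i a where
  injective a b h := by
    obtain ⟨i, hi, hab⟩ := (hf.and (toQuotient_reductionFilter_eq_iff.1 h)).exists
    exact hi.injective hab
  map_mul _ _ := toQuotient_reductionFilter_eq_iff.2 (hf.mono fun _ h => h.map_mul _ _)
  map_himp _ _ := toQuotient_reductionFilter_eq_iff.2 (hf.mono fun _ h => h.map_himp _ _)
  map_inf _ _ := toQuotient_reductionFilter_eq_iff.2 (hf.mono fun _ h => h.map_inf _ _)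
  map_sup _ _ := toQuotient_reductionFilter_eq_iff.2 (hf.mono fun _ h => h.map_sup _ _)
  map_bot := toQuotient_reductionFilter_eq_iff.2 (hf.mono fun _ h => h.map_bot)
  map_one := toQuotient_reductionFilter_eq_iff.2 (hf.mono fun _ h => h.map_one)

section Completeness

variable {L Γ : Set Formula} {φ : Formula}

theorem IsLAlgebra.exists_chain_eval_ne_one {A : Type u} [MTLAlgebra A] (hA : IsLAlgebra L A)
    {v : ℕ → A} (h : eval v φ ≠ 1) :
    ∃ (C : Type u) (_ : MTLAlgebra C) (w : ℕ → C), IsLChain L C ∧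
      (∀ γ, eval v γ = 1 → eval w γ = 1) ∧ eval w φ ≠ 1 := by
  obtain ⟨F, hF, hφ⟩ := exists_isPrime_notMem h
  refine ⟨F.Quotient, inferInstance, fun n => F.toQuotient (v n), hF.isLChain_quotient hA,
    fun γ hγ => ?_, ?_⟩
  · rw [F.eval_toQuotient, hγ]
    rfl
  · rwa [F.eval_toQuotient, Ne, F.toQuotient_eq_one_iff]

theorem exists_chain_of_not_provable (h : ¬ Provable L Γ φ) :
    ∃ (A : Type u) (_ : MTLAlgebra A) (v : ℕ → A), IsLChain L A ∧ (∀ γ ∈ Γ, eval v γ = 1) ∧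
      eval v φ ≠ 1 := by
  -- The power over a one-point set moves the Lindenbaum algebra to the universe `u`.
  let v : ℕ → PUnit.{u + 1} → Lindenbaum L Γ := fun n _ => Lindenbaum.mk L Γ (var n)
  have eval_v (ψ : Formula) : eval v ψ = 1 ↔ Provable L Γ ψ := by
    rw [funext_iff, ← Lindenbaum.mk_eq_one_iff, ← Lindenbaum.eval_mk_var]
    simp only [eval_apply, v, Pi.one_apply, forall_const]
  obtain ⟨C, _, w, hC, hw, hφ⟩ :=
    (isLAlgebra_pi fun _ => Lindenbaum.isLAlgebra L Γ).exists_chain_eval_ne_one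
      (mt (eval_v φ).1 h)
  exact ⟨C, _, w, hC, fun γ hγ => hw γ ((eval_v γ).2 (.hyp hγ)), hφ⟩

end Completeness

section JointEmbedding

variable {L : Set Formula}

theorem CJEP.exists_chain_finset (hL : CJEP.{u} L) {I : Type*} [Nonempty I] (A : I → Type u)
    [∀ i, MTLAlgebra (A i)] [∀ i, Nontrivial (A i)] (hA : ∀ i, IsLChain L (A i)) (s : Finset I) :
    ∃ (C : Type u) (_ : MTLAlgebra C), Nontrivial C ∧ IsLChain L C ∧
      ∀ i ∈ s, ∃ f : A i → C, IsEmbedding f := by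
  induction s using Finset.cons_induction with
  | empty => exact ⟨A (Classical.arbitrary I), inferInstance, inferInstance, hA _, by simp⟩
  | cons i s _ ih =>
    obtain ⟨C, _, _, hC, hs⟩ := ih
    obtain ⟨D, _, hD, ⟨g, hg⟩, hi⟩ := hL C (A i) hC (hA i)
    refine ⟨D, inferInstance, hg.injective.nontrivial, hD,
      (Finset.forall_mem_cons _ _).2 ⟨hi, fun j hj => ?_⟩⟩
    obtain ⟨f, hf⟩ := hs j hj
    exact ⟨g ∘ f, hg.comp hf⟩

theorem CJEP.exists_chain {I : Type v} (hL : CJEP.{max u v} L) [Nonempty I]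
    (A : I → Type (max u v)) [∀ i, MTLAlgebra (A i)] [∀ i, Nontrivial (A i)]
    (hA : ∀ i, IsLChain L (A i)) :
    ∃ (C : Type (max u v)) (_ : MTLAlgebra C), IsLChain L C ∧
      ∀ i, ∃ f : A i → C, IsEmbedding f := by
  choose C inst _ hC hf using hL.exists_chain_finset A hA
  let U : Ultrafilter (Finset I) := .of atTop
  refine ⟨(reductionFilter C (U : Filter (Finset I))).Quotient, inferInstance,
    isLChain_ultraproduct U hC, fun i => ?_⟩
  have exists_map (s : Finset I) : ∃ f : A i → C s, i ∈ s → IsEmbedding f := by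
    by_cases hi : i ∈ s
    · obtain ⟨f, hf⟩ := hf s i hi
      exact ⟨f, fun _ => hf⟩
    · exact ⟨fun _ => ⊥, fun h => (hi h).elim⟩
  choose f hf using exists_map
  have eventually_mem : ∀ᶠ s in (U : Filter (Finset I)), i ∈ s :=
    Ultrafilter.of_le _ <| (eventually_ge_atTop {i}).mono fun _ => Finset.singleton_subset_iff.1
  exact ⟨_, isEmbedding_reducedProduct.{u} (eventually_mem.mono hf)⟩

instance : MTLAlgebra PUnit.{u + 1} where
  one_eq_top := rfl
  residuation _ _ _ := Iff.rfl
  prelinearity _ _ := rfl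

theorem isLChain_punit : IsLChain L PUnit.{u + 1} :=
  ⟨fun _ _ _ => rfl, fun _ _ => .inl le_rfl⟩

theorem CJEP.sscc (hL : CJEP.{u} L) : SSCC.{u} L := by
  let I := {p : Set Formula × Formula // ¬ Provable L p.1 p.2}
  rcases isEmpty_or_nonempty I with hI | _
  · refine ⟨PUnit, inferInstance, isLChain_punit, fun Γ φ => ⟨fun h => h.entails isLChain_punit.1,
      fun _ => ?_⟩⟩
    by_contra h
    exact hI.false ⟨(Γ, φ), h⟩
  choose A inst v hA hΓ hφ using fun p : I => exists_chain_of_not_provable.{u} p.2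
  have (p : I) : Nontrivial (A p) := nontrivial_of_ne _ _ (hφ p)
  obtain ⟨C, _, hC, hf⟩ := CJEP.exists_chain.{u, 0} hL A hA
  refine ⟨C, inferInstance, hC, fun Γ φ => ⟨fun h => h.entails hC.1, fun h => ?_⟩⟩
  by_contra hn
  obtain ⟨f, hf⟩ := hf ⟨(Γ, φ), hn⟩
  refine hφ ⟨(Γ, φ), hn⟩ ((hf.eval_eq_one_iff _ _).1 (h _ fun γ hγ => ?_))
  exact (hf.eval_eq_one_iff _ _).2 (hΓ ⟨(Γ, φ), hn⟩ γ hγ)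

end JointEmbedding

section VariableSeparation

variable {L : Set Formula}

theorem vars_subset_varsOf {Γ : Set Formula} {φ : Formula} (h : φ ∈ Γ) : φ.vars ⊆ varsOf Γ :=
  Set.subset_biUnion_of_mem (u := Formula.vars) h

theorem CJEP.exists_common_assignment (hL : CJEP.{u} L) {A B : Type u} [MTLAlgebra A]
    [MTLAlgebra B] [Nontrivial A] [Nontrivial B] (hA : IsLChain L A) (hB : IsLChain L B)
    {s t : Set ℕ} (hst : Disjoint s t) (v : ℕ → A) (w : ℕ → B) :
    ∃ (C : Type u) (_ : MTLAlgebra C) (z : ℕ → C), IsLChain L C ∧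
      (∀ χ : Formula, χ.vars ⊆ s → (eval z χ = 1 ↔ eval v χ = 1)) ∧
      ∀ χ : Formula, χ.vars ⊆ t → (eval z χ = 1 ↔ eval w χ = 1) := by
  classical
  obtain ⟨C, _, hC, ⟨f, hf⟩, ⟨g, hg⟩⟩ := hL A B hA hB
  refine ⟨C, inferInstance, s.piecewise (fun n => f (v n)) (fun n => g (w n)), hC,
    fun χ hχ => ?_, fun χ hχ => ?_⟩
  · rw [← hf.eval_eq_one_iff, eval_congr ((s.piecewise_eqOn _ _).mono hχ)]
  · rw [← hg.eval_eq_one_iff,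
      eval_congr ((s.piecewise_eqOn_compl _ _).mono (hχ.trans hst.subset_compl_left))]

theorem CJEP.dmvp (hL : CJEP.{u} L) : DMVP L := by
  intro Γ Δ φ ψ hdisj h
  by_contra! hn
  obtain ⟨A, _, v, hA, hΓ, hφ⟩ := exists_chain_of_not_provable.{u} hn.1
  obtain ⟨B, _, w, hB, hΔ, hψ⟩ := exists_chain_of_not_provable.{u} hn.2
  have := nontrivial_of_ne _ _ hφ
  have := nontrivial_of_ne _ _ hψ
  obtain ⟨C, _, z, hC, hzv, hzw⟩ := hL.exists_common_assignment hA hB hdisj v w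
  replace hzv {χ} (hχ : χ ∈ Γ ∪ {φ}) := hzv χ (vars_subset_varsOf hχ)
  replace hzw {χ} (hχ : χ ∈ Δ ∪ {ψ}) := hzw χ (vars_subset_varsOf hχ)
  have eval_disj_eq_one : eval z (φ.disj ψ) = 1 := h.entails hC.1 z <| by
    rintro γ (hγ | hγ)
    · exact (hzv (.inl hγ)).2 (hΓ γ hγ)
    · exact (hzw (.inl hγ)).2 (hΔ γ hγ)
  rw [eval_disj] at eval_disj_eq_one
  rcases eq_one_or_eq_one_of_sup_eq_one (hC.2 _ _) eval_disj_eq_one with h | h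
  · exact hφ ((hzv (.inr rfl)).1 h)
  · exact hψ ((hzw (.inr rfl)).1 h)

theorem DMVP.hc (hL : DMVP L) : HC L := by
  intro φ ψ hdisj h
  refine hL ∅ ∅ φ ψ ?_ (by rwa [Set.empty_union])
  simpa [varsOf] using hdisj

theorem varsOf_union_bot (Γ : Set Formula) : varsOf (Γ ∪ {bot}) = varsOf Γ := by
  simp [varsOf, Formula.vars]

theorem DMVP.sdprp (hL : DMVP L) : SDPRP L := by
  intro Γ Δ ψ hdisj h
  exact hL Γ Δ bot ψ (by rwa [varsOf_union_bot]) (.mp h (.imp_disj_right _ _))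

theorem SDPRP.dprp (hL : SDPRP L) : DPRP L := by
  intro Γ ψ hdisj h
  refine hL Γ ∅ ψ ?_ (by rwa [Set.union_empty])
  simpa [varsOf] using hdisj

end VariableSeparation

end MTL

theorem mainTheorem7 (L : Set MTL.Formula) :
    (MTL.CJEP.{u} L → MTL.SSCC.{u} L ∧ MTL.HC L ∧ MTL.DMVP L ∧ MTL.SDPRP L) ∧
      (MTL.DMVP L → MTL.DPRP L) :=
  ⟨fun h => ⟨h.sscc, h.dmvp.hc, h.dmvp, h.dmvp.sdprp⟩, fun h => h.sdprp.dprp⟩
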